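/- Let $0<p<1/2$, let $0<\epsilon\le 1/2$ and let $M\ge 1$ be an integer. A message $\theta$, uniformly distributed on $\{1,\dots,M\}$, is sent over the binary symmetric channel with crossover probability $p$ with noiseless feedback: at time $t+1$ the channel input $X_{t+1}=e_{t+1}(\theta,Y^t)\in\{0,1\}$ is a function of the message and of the past channel outputs $Y^t=(Y_1,\dots,Y_t)$, and, given $\theta$ and $Y^t$, the output $Y_{t+1}$ equals $X_{t+1}$ with probability $1-p$ and $1-X_{t+1}$ with probability $p$. Let $\rho_i(t)=\Pr\{\theta=i\mid Y^t\}$, and let transmission stop at $$\tau=\min\{t\ge 0:\ \max_{1\le i\le M}\rho_i(t)\ge 1-\epsilon\},\qquad \tau=\infty\text{ if there is no such } t$$ (the receiver then decides for the most likely message). Suppose that the encoder follows the small-enough-difference (SED) rule: for every $t<\tau$ the sets $S_x(t)=\{i: e_{t+1}(i,Y^t)=x\}$, $x\in\{0,1\}$, satisfy $$0\le\sum_{i\in S_0(t)}\rho_i(t)-\sum_{i\in S_1(t)}\rho_i(t)\le\min_{i\in S_0(t)}\rho_i(t)$$ (the left inequality forces $S_0(t)\neq\emptyset$). Then $$\mathbb{E}[\tau]\le\frac{\log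 M}{C}+\frac{\log\frac{1-\epsilon}{\epsilon}}{C_1}+\frac{3C_2^2}{C\,C_1},$$ where all logarithms have base 2 and, for the transition probabilities $P(y|x)$ of the channel, $C=\max_{P_X}I(X;Y)$ is the capacity, $C_1=\max_{x,x'}D\big(P(\cdot|x)\,\|\,P(\cdot|x')\big)$ is the maximal Kullback–Leibler divergence, and $C_2=\max_y\log\frac{\max_xP(y|x)}{\min_xP(y|x)}$; that is, $C=1+p\log p+(1-p)\log(1-p)$, $C_1=(1-2p)\log\frac{1-p}{p}$ and $C_2=\log\frac{1-p}{p}$. In particular, $\tau$ is almost surely finite. -/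

import Mathlib

namespace FeedbackBSC

open MeasureTheory

noncomputable section

/- Discrete memoryless channels.  A channel with finite input alphabet `A` and finite output
alphabet `B` is given by its transition matrix: `W x y` is `P(Y = y | X = x)`. -/

/-- The transition matrix of the binary symmetric channel with crossover probability `p`. -/
def bsc (p : ℝ) (x y : Fin 2) : ℝ := if y = x then 1 - p else p

/-- The mutual information `I(X;Y)`, in bits, for the input distribution `π`. -/
def mutualInfo {A B : Type*} [Fintype A] [Fintype B] (W : A → B → ℝ) (π : A → ℝ) : ℝ :=
  ∑ x, ∑ y, π x * W x y * Real.logb 2 (W x y / ∑ x', π x' * W x' y)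

/-- Shannon capacity `C = max_{P_X} I(X;Y)`; `stdSimplex ℝ A` is the set of probability
vectors on `A`. -/
def capacity {A B : Type*} [Fintype A] [Fintype B] (W : A → B → ℝ) : ℝ :=
  sSup (mutualInfo W '' stdSimplex ℝ A)

/-- Kullback-Leibler divergence `D(P ‖ Q)`, in bits, of two probability vectors on a finite set
(used only where `Q` has no zero entry). -/
def klDivBits {B : Type*} [Fintype B] (P Q : B → ℝ) : ℝ :=
  ∑ y, P y * Real.logb 2 (P y / Q y)

/-- `C₁ = max_{x,x'} D(P(Y|X=x) ‖ P(Y|X=x'))`. -/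
def constC₁ {A B : Type*} [Fintype B] (W : A → B → ℝ) : ℝ :=
  ⨆ z : A × A, klDivBits (W z.1) (W z.2)

/-- `C₂ = max_y log₂ (max_x P(Y=y|X=x) / min_x P(Y=y|X=x))`. -/
def constC₂ {A B : Type*} (W : A → B → ℝ) : ℝ :=
  ⨆ y : B, Real.logb 2 ((⨆ x : A, W x y) / (⨅ x : A, W x y))

/- Transmission with noiseless feedback.  Sequences are indexed from `0`: the value `Y k ω` is the
output `Y_{k+1}` of the `(k+1)`-st channel use. -/

variable {Ω A B : Type*}

/-- The first `t` channel outputs `Y^t = (Y_1, …, Y_t)`. -/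
def history (Y : ℕ → Ω → B) (t : ℕ) (ω : Ω) : Fin t → B := fun k => Y k ω

/-- A feedback encoder for `M` messages: `e t i y` is the channel input `X_{t+1}` for message `i`
after the outputs `Y^t = y`. -/
abbrev Encoder (M : ℕ) (A B : Type*) : Type _ := (t : ℕ) → Fin M → (Fin t → B) → A

/-- `θ` is a uniformly distributed message that is sent with the encoder `e` over the memoryless
channel `W` with noiseless feedback, `Y` being the channel outputs: the conditional probability of
`Y_{t+1} = b` given `θ = i` and `Y^t = y` is `W (e t i y) b`. -/
structure IsTransmission [MeasurableSpace Ω] [MeasurableSpace B] (W : A → B → ℝ) (μ : Measure Ω)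
    {M : ℕ} (θ : Ω → Fin M) (Y : ℕ → Ω → B) (e : Encoder M A B) : Prop where
  measurable_message : Measurable θ
  measurable_output : ∀ t, Measurable (Y t)
  uniform : ∀ i, μ.real {ω | θ ω = i} = 1 / (M : ℝ)
  channel : ∀ (t : ℕ) (i : Fin M) (y : Fin t → B) (b : B),
    μ.real {ω | θ ω = i ∧ history Y t ω = y ∧ Y t ω = b}
      = μ.real {ω | θ ω = i ∧ history Y t ω = y} * W (e t i y) b

/-- The belief `Pr{θ = i | Y^t = y}` of the receiver. -/
def belief [MeasurableSpace Ω] (μ : Measure Ω) {M : ℕ} (θ : Ω → Fin M) (Y : ℕ → Ω → B)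
    (t : ℕ) (y : Fin t → B) (i : Fin M) : ℝ :=
  (ProbabilityTheory.cond μ {ω | history Y t ω = y}).real {ω | θ ω = i}

/-- The posterior probability `ρ_i(t) = Pr{θ = i | Y^t}`, a random variable. -/
def posterior [MeasurableSpace Ω] (μ : Measure Ω) {M : ℕ} (θ : Ω → Fin M) (Y : ℕ → Ω → B)
    (i : Fin M) (t : ℕ) (ω : Ω) : ℝ :=
  belief μ θ Y t (history Y t ω) i

/-- The stopping time `τ = min {t : max_i ρ_i(t) ≥ 1 - ε}`, equal to `⊤` if there is no such
`t`. -/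
def stopTime [MeasurableSpace Ω] (μ : Measure Ω) {M : ℕ} (θ : Ω → Fin M) (Y : ℕ → Ω → B)
    (ε : ℝ) (ω : Ω) : ℕ∞ :=
  sInf ((fun t : ℕ => (t : ℕ∞)) '' {t : ℕ | ∃ i, 1 - ε ≤ posterior μ θ Y i t ω})

/-- The probability `∑_{i ∈ S_x(t)} ρ_i(t)` of the set `S_x(t)` of the messages for which the
encoder sends the symbol `x` at time `t + 1`. -/
def partMass [MeasurableSpace Ω] (μ : Measure Ω) {M : ℕ} (θ : Ω → Fin M) (Y : ℕ → Ω → B)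
    (e : Encoder M (Fin 2) B) (x : Fin 2) (t : ℕ) (ω : Ω) : ℝ :=
  ∑ i with e t i (history Y t ω) = x, posterior μ θ Y i t ω

/-- The small-enough-difference (SED) rule, at every time at which a symbol is still to be sent:
`0 ≤ ∑_{i ∈ S_0(t)} ρ_i(t) - ∑_{i ∈ S_1(t)} ρ_i(t) ≤ min_{j ∈ S_0(t)} ρ_j(t)`.
Equality on the right is allowed: without it no partition of three equally likely messages would
satisfy the rule.  An empty `S_0(t)` is excluded by the left inequality. -/
def IsSED [MeasurableSpace Ω] (μ : Measure Ω) {M : ℕ} (θ : Ω → Fin M) (Y : ℕ → Ω → B)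
    (e : Encoder M (Fin 2) B) (ε : ℝ) : Prop :=
  ∀ (ω : Ω) (t : ℕ), (t : ℕ∞) < stopTime μ θ Y ε ω →
    0 ≤ partMass μ θ Y e 0 t ω - partMass μ θ Y e 1 t ω ∧
    ∀ j, e t j (history Y t ω) = 0 →
      partMass μ θ Y e 0 t ω - partMass μ θ Y e 1 t ω ≤ posterior μ θ Y j t ω

end

end FeedbackBSC

open FeedbackBSC

namespace FeedbackBSC
open MeasureTheory

/-! Fix the sent message i and follow its base-2 log odds u against all other messages. The SED rule
has two consequences while transmission lasts (`IsSED.otherMass_le`). The competitors that share the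
input of i carry at most half of the competing mass, so u has drift at least C
(`bscCapacity_le_drift`). Once u ≥ 0, no competitor shares that input, and u makes steps ±C₂ with
drift C₁.

The potential has slope -1/C below zero. Above zero it has slope -1/C₁ plus a multiple of 2^(-u), a
martingale there, which pays for returns below zero. Each branch dominates the potential wherever a
step from its side can land, so the mean potential falls by at least 1 per step
(`potential_step_of_neg`, `potential_step_of_nonneg`).

Averaging over messages and histories gives P(τ > t) ≤ Φ(t) - Φ(t+1) with Φ ≥ 0
(`measureReal_lt_stopTime_le`). The sum telescopes to E[τ] ≤ Φ(0), without assuming τ finite. -/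

/-- A Lyapunov function for a walk with drift `K₁` below zero and drift `K₂` above zero, whose
steps are at most `K₃`, and which is stopped above the level `β`. -/
noncomputable def potential (K₁ K₂ K₃ β u : ℝ) : ℝ :=
  if u < 0 then (β + K₃) / K₂ + K₃ ^ 2 / (K₁ * K₂) - u / K₁
  else (β + K₃) / K₂ - u / K₂ + K₃ ^ 2 / (K₁ * K₂) * (2 : ℝ) ^ (-u)

/-! ### Drift inequalities for the Lyapunov function -/

section potential

variable {K₁ K₂ K₃ β u : ℝ}

/-- The `K₃` in `(β + K₃) / K₂` allows for the overshoot of the last step beyond `β`. -/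
lemma potential_nonneg (h₁ : 0 < K₁) (h₂ : 0 < K₂) (h₃ : 0 < K₃) (hβ : 0 ≤ β)
    (hu : u ≤ β + K₃) : 0 ≤ potential K₁ K₂ K₃ β u := by
  unfold potential
  split_ifs with h
  · have := div_nonpos_of_nonpos_of_nonneg h.le h₁.le
    have : 0 ≤ (β + K₃) / K₂ + K₃ ^ 2 / (K₁ * K₂) := by positivity
    linarith
  · rw [← sub_div]
    have := div_nonneg (sub_nonneg.2 hu) h₂.le
    positivity

/-- By convexity, 2^(-u) lies below its chord on [0, K₃]. -/
lemma one_sub_two_rpow_neg_ge (h₃ : 0 < K₃) (hu₀ : 0 ≤ u) (hu : u ≤ K₃) :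
    u / K₃ * (1 - (2 : ℝ) ^ (-K₃)) ≤ 1 - (2 : ℝ) ^ (-u) := by
  have hc := convexOn_exp.2 (Set.mem_univ 0) (Set.mem_univ (-(K₃ * Real.log 2)))
    (sub_nonneg.2 ((div_le_one h₃).2 hu)) (div_nonneg hu₀ h₃.le) (sub_add_cancel 1 (u / K₃))
  have e₁ : (2 : ℝ) ^ (-K₃) = Real.exp (-(K₃ * Real.log 2)) := by
    rw [Real.rpow_def_of_pos two_pos]; congr 1; ring
  have e₂ : (2 : ℝ) ^ (-u) =
      Real.exp ((1 - u / K₃) • 0 + (u / K₃) • (-(K₃ * Real.log 2))) := by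
    rw [Real.rpow_def_of_pos two_pos]; congr 1; simp only [smul_eq_mul]; field_simp; ring
  rw [← e₂, ← e₁, Real.exp_zero, smul_eq_mul, smul_eq_mul] at hc
  linarith

/-- By the chord bound and `hK`, the exponential term has dropped by at least u/K₁ at each u in [0,
K₃]. A step from below zero lands no higher than `K₃`. -/
lemma potential_le_linear (h₁ : 0 < K₁) (h₂ : 0 < K₂) (h₃ : 0 < K₃)
    (hK : K₃ / K₁ ≤ K₃ ^ 2 / (K₁ * K₂) * (1 - (2 : ℝ) ^ (-K₃))) (hu : u ≤ K₃) :
    potential K₁ K₂ K₃ β u ≤ (β + K₃) / K₂ + K₃ ^ 2 / (K₁ * K₂) - u / K₁ := by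
  unfold potential
  split_ifs with h
  · exact le_rfl
  · push Not at h
    have hc := mul_le_mul_of_nonneg_left (one_sub_two_rpow_neg_ge h₃ h hu)
      (by positivity : 0 ≤ K₃ ^ 2 / (K₁ * K₂))
    have hd := mul_le_mul_of_nonneg_left hK (by positivity : 0 ≤ u / K₃)
    have e : u / K₃ * (K₃ / K₁) = u / K₁ := by field_simp
    have : 0 ≤ u / K₂ := by positivity
    rw [e] at hd
    linarith

/-- Below zero, compare 2^(-u) with its tangent at 0. Since 1 - 2^(-K₃) ≤ K₃ log 2, `hK` makes the
tangent of the exponential term at least as steep as 1/K₁. -/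
lemma potential_le_exponential (h₁ : 0 < K₁) (h₂ : 0 < K₂) (h₃ : 0 < K₃)
    (hK : K₃ / K₁ ≤ K₃ ^ 2 / (K₁ * K₂) * (1 - (2 : ℝ) ^ (-K₃))) :
    potential K₁ K₂ K₃ β u
      ≤ (β + K₃) / K₂ - u / K₂ + K₃ ^ 2 / (K₁ * K₂) * (2 : ℝ) ^ (-u) := by
  unfold potential
  split_ifs with h
  · have hexp (v : ℝ) : 1 + v * Real.log 2 ≤ (2 : ℝ) ^ v := by
      rw [Real.rpow_def_of_pos two_pos]
      have := Real.add_one_le_exp (Real.log 2 * v)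
      linarith
    have ha : 0 ≤ K₃ ^ 2 / (K₁ * K₂) := by positivity
    have hA : K₃ / K₁ ≤ K₃ ^ 2 / (K₁ * K₂) * (K₃ * Real.log 2) :=
      hK.trans (mul_le_mul_of_nonneg_left (by linarith [hexp (-K₃)]) ha)
    have hd := mul_le_mul_of_nonneg_left hA (div_nonneg (neg_nonneg.2 h.le) h₃.le)
    have e₁ : -u / K₃ * (K₃ / K₁) = -(u / K₁) := by field_simp
    have e₂ : -u / K₃ * (K₃ ^ 2 / (K₁ * K₂) * (K₃ * Real.log 2))
        = K₃ ^ 2 / (K₁ * K₂) * (-u * Real.log 2) := by field_simp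
    rw [e₁, e₂] at hd
    have hc := mul_le_mul_of_nonneg_left (hexp (-u)) ha
    have : u / K₂ ≤ 0 := div_nonpos_of_nonpos_of_nonneg h.le h₂.le
    linarith
  · exact le_rfl

lemma potential_step_of_neg (h₁ : 0 < K₁) (h₂ : 0 < K₂) (h₃ : 0 < K₃)
    (hK : K₃ / K₁ ≤ K₃ ^ 2 / (K₁ * K₂) * (1 - (2 : ℝ) ^ (-K₃))) {q r d d' : ℝ}
    (hq : 0 ≤ q) (hr : 0 ≤ r) (hqr : q + r = 1) (hu : u < 0) (hd : d ≤ K₃) (hd' : d' ≤ K₃)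
    (hdrift : K₁ ≤ q * d + r * d') :
    q * potential K₁ K₂ K₃ β (u + d) + r * potential K₁ K₂ K₃ β (u + d') + 1
      ≤ potential K₁ K₂ K₃ β u := by
  have i₁ := mul_le_mul_of_nonneg_left
    (potential_le_linear (β := β) h₁ h₂ h₃ hK (by linarith : u + d ≤ K₃)) hq
  have i₂ := mul_le_mul_of_nonneg_left
    (potential_le_linear (β := β) h₁ h₂ h₃ hK (by linarith : u + d' ≤ K₃)) hr
  have e : potential K₁ K₂ K₃ β u = (β + K₃) / K₂ + K₃ ^ 2 / (K₁ * K₂) - u / K₁ := by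
    simp [potential, hu]
  have hD : 1 ≤ (q * d + r * d') / K₁ := by rwa [le_div_iff₀ h₁, one_mul]
  obtain rfl : r = 1 - q := by linarith
  rw [e]
  have : q * ((β + K₃) / K₂ + K₃ ^ 2 / (K₁ * K₂) - (u + d) / K₁)
      + (1 - q) * ((β + K₃) / K₂ + K₃ ^ 2 / (K₁ * K₂) - (u + d') / K₁)
      = (β + K₃) / K₂ + K₃ ^ 2 / (K₁ * K₂) - u / K₁ - (q * d + (1 - q) * d') / K₁ := by ring
  linarith

/-- By `hexp` the exponential term keeps its mean, so only the affine term contributes to the drift.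
-/
lemma potential_step_of_nonneg (h₁ : 0 < K₁) (h₂ : 0 < K₂) (h₃ : 0 < K₃)
    (hK : K₃ / K₁ ≤ K₃ ^ 2 / (K₁ * K₂) * (1 - (2 : ℝ) ^ (-K₃))) {q r : ℝ}
    (hq : 0 ≤ q) (hr : 0 ≤ r) (hqr : q + r = 1) (hu : 0 ≤ u) (hdrift : K₂ = (q - r) * K₃)
    (hexp : q * (2 : ℝ) ^ (-K₃) + r * (2 : ℝ) ^ K₃ = 1) :
    q * potential K₁ K₂ K₃ β (u + K₃) + r * potential K₁ K₂ K₃ β (u + -K₃) + 1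
      ≤ potential K₁ K₂ K₃ β u := by
  have i₁ := mul_le_mul_of_nonneg_left
    (potential_le_exponential (β := β) (u := u + K₃) h₁ h₂ h₃ hK) hq
  have i₂ := mul_le_mul_of_nonneg_left
    (potential_le_exponential (β := β) (u := u + -K₃) h₁ h₂ h₃ hK) hr
  have e : potential K₁ K₂ K₃ β u
      = (β + K₃) / K₂ - u / K₂ + K₃ ^ 2 / (K₁ * K₂) * (2 : ℝ) ^ (-u) := by
    simp [potential, hu.not_gt]
  have hD : ((q - r) * K₃) / K₂ = 1 := by rw [← hdrift, div_self h₂.ne']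
  have e₁ : (2 : ℝ) ^ (-(u + K₃)) = (2 : ℝ) ^ (-u) * (2 : ℝ) ^ (-K₃) := by
    rw [← Real.rpow_add two_pos]; ring_nf
  have e₂ : (2 : ℝ) ^ (-(u + -K₃)) = (2 : ℝ) ^ (-u) * (2 : ℝ) ^ K₃ := by
    rw [← Real.rpow_add two_pos]; ring_nf
  rw [e₁] at i₁
  rw [e₂] at i₂
  rw [e]
  have : q * ((β + K₃) / K₂ - (u + K₃) / K₂
        + K₃ ^ 2 / (K₁ * K₂) * ((2 : ℝ) ^ (-u) * (2 : ℝ) ^ (-K₃)))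
      + r * ((β + K₃) / K₂ - (u + -K₃) / K₂
        + K₃ ^ 2 / (K₁ * K₂) * ((2 : ℝ) ^ (-u) * (2 : ℝ) ^ K₃))
      = (q + r) * ((β + K₃) / K₂ - u / K₂) - ((q - r) * K₃) / K₂
        + K₃ ^ 2 / (K₁ * K₂) * (2 : ℝ) ^ (-u) * (q * (2 : ℝ) ^ (-K₃) + r * (2 : ℝ) ^ K₃) := by
    ring
  rw [hexp, hqr, hD] at this
  linarith

end potential

/-! ### Constants of the binary symmetric channel -/

/-- The closed form of the capacity of the binary symmetric channel. -/
noncomputable def bscCapacity (p : ℝ) : ℝ :=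
  1 + p * Real.logb 2 p + (1 - p) * Real.logb 2 (1 - p)

/-- The log-likelihood ratio of the binary symmetric channel. -/
noncomputable def bscLLR (p : ℝ) : ℝ := Real.logb 2 ((1 - p) / p)

section constants

variable {p : ℝ}

lemma bscLLR_pos (hp₀ : 0 < p) (hp₁ : p < 1 / 2) : 0 < bscLLR p :=
  Real.logb_pos one_lt_two (by rw [lt_div_iff₀ hp₀]; linarith)

lemma two_rpow_bscLLR (hp₀ : 0 < p) (hp₁ : p < 1 / 2) : (2 : ℝ) ^ bscLLR p = (1 - p) / p :=
  Real.rpow_logb two_pos (by norm_num) (div_pos (by linarith) hp₀)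

lemma bscCapacity_eq_binEntropy (p : ℝ) :
    bscCapacity p = (Real.log 2 - Real.binEntropy p) / Real.log 2 := by
  have := Real.log_pos one_lt_two
  rw [bscCapacity, Real.binEntropy_eq_negMulLog_add_negMulLog_one_sub]
  simp only [Real.negMulLog, Real.logb]
  field_simp
  ring

lemma bscCapacity_pos (hp₁ : p < 1 / 2) : 0 < bscCapacity p := by
  rw [bscCapacity_eq_binEntropy]
  refine div_pos (sub_pos.2 (Real.binEntropy_lt_log_two.2 ?_)) (Real.log_pos one_lt_two)
  rw [one_div] at hp₁
  exact hp₁.ne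

lemma bscCapacity_le_bscLLR (hp₀ : 0 < p) (hp₁ : p < 1 / 2) : bscCapacity p ≤ bscLLR p := by
  rw [bscCapacity, bscLLR, Real.logb_div (by linarith) hp₀.ne']
  have h₁ : Real.logb 2 p ≤ -1 := by
    have := Real.logb_le_logb_of_le one_lt_two hp₀ hp₁.le
    rwa [one_div, Real.logb_inv, Real.logb_self_eq_one one_lt_two] at this
  have h₂ : Real.logb 2 (1 - p) ≤ 0 := Real.logb_nonpos one_lt_two (by linarith) (by linarith)
  have h₃ : -1 ≤ Real.logb 2 (1 - p) := by
    have := Real.logb_le_logb_of_le one_lt_two (by norm_num) (by linarith : (1 : ℝ) / 2 ≤ 1 - p)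
    rwa [one_div, Real.logb_inv, Real.logb_self_eq_one one_lt_two] at this
  nlinarith

/-- This is I = H(Y) - H(p); the bracket is the amount by which the output entropy falls short of
one bit. -/
lemma mutualInfo_bsc (hp₀ : 0 < p) (hp₁ : p < 1 / 2) {π : Fin 2 → ℝ}
    (hπ : π ∈ stdSimplex ℝ (Fin 2)) :
    mutualInfo (bsc p) π = bscCapacity p
      - (1 - Real.binEntropy (π 0 * (1 - p) + π 1 * p) / Real.log 2) := by
  have h0 := hπ.1 0
  have h1 := hπ.1 1
  have hs : π 1 = 1 - π 0 := by have := hπ.2; rw [Fin.sum_univ_two] at this; linarith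
  rw [hs] at h1
  have hr : 0 < π 0 * (1 - p) + (1 - π 0) * p := by nlinarith
  have hr' : 0 < π 0 * p + (1 - π 0) * (1 - p) := by nlinarith
  have hl := (Real.log_pos one_lt_two).ne'
  rw [bscCapacity_eq_binEntropy, Real.binEntropy_eq_negMulLog_add_negMulLog_one_sub,
    Real.binEntropy_eq_negMulLog_add_negMulLog_one_sub]
  simp only [mutualInfo, Fin.sum_univ_two, bsc, hs, Real.negMulLog]
  have e : 1 - (π 0 * (1 - p) + (1 - π 0) * p) = π 0 * p + (1 - π 0) * (1 - p) := by ring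
  rw [e]
  simp only [if_true, Fin.isValue, zero_ne_one, one_ne_zero, if_false]
  rw [Real.logb_div (by linarith) hr.ne', Real.logb_div (by linarith) hr'.ne',
    Real.logb_div (by linarith) hr.ne', Real.logb_div (by linarith) hr'.ne']
  simp only [Real.logb]
  field_simp
  ring

lemma capacity_bsc (hp₀ : 0 < p) (hp₁ : p < 1 / 2) : capacity (bsc p) = bscCapacity p := by
  have hl := Real.log_pos one_lt_two
  refine IsGreatest.csSup_eq ⟨⟨fun _ => 1 / 2, ?_, ?_⟩, ?_⟩
  · exact ⟨fun _ => by norm_num, by simp⟩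
  · rw [mutualInfo_bsc hp₀ hp₁ ⟨fun _ => by norm_num, by simp⟩]
    have : (1 : ℝ) / 2 * (1 - p) + 1 / 2 * p = 2⁻¹ := by ring
    simp only [this, Real.binEntropy_two_inv, div_self hl.ne', sub_self, sub_zero]
  · rintro _ ⟨π, hπ, rfl⟩
    rw [mutualInfo_bsc hp₀ hp₁ hπ]
    have := (div_le_one hl).2 (Real.binEntropy_le_log_two (p := π 0 * (1 - p) + π 1 * p))
    linarith

lemma bscLLR_inv (p : ℝ) : Real.logb 2 (p / (1 - p)) = -bscLLR p := by
  rw [bscLLR, ← Real.logb_inv, inv_div]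

lemma constC₁_bsc (hp₀ : 0 < p) (hp₁ : p < 1 / 2) :
    constC₁ (bsc p) = (1 - 2 * p) * bscLLR p := by
  have hL := bscLLR_pos hp₀ hp₁
  have hq : 1 - p ≠ 0 := by linarith
  have h01 : klDivBits (bsc p 0) (bsc p 1) = (1 - 2 * p) * bscLLR p := by
    simp [klDivBits, bsc, bscLLR_inv]
    rw [← bscLLR]; ring
  have h10 : klDivBits (bsc p 1) (bsc p 0) = (1 - 2 * p) * bscLLR p := by
    simp [klDivBits, bsc, bscLLR_inv]
    rw [← bscLLR]; ring
  have hd (x : Fin 2) : klDivBits (bsc p x) (bsc p x) = 0 := by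
    fin_cases x <;> simp [klDivBits, bsc, hq, hp₀.ne']
  refine le_antisymm (ciSup_le ?_) ?_
  · have : 0 ≤ (1 - 2 * p) * bscLLR p := mul_nonneg (by linarith) hL.le
    rintro ⟨x, x'⟩
    fin_cases x <;> fin_cases x' <;> simp [h01, h10, hd, this]
  · rw [← h01]
    exact le_ciSup (f := fun z : Fin 2 × Fin 2 => klDivBits (bsc p z.1) (bsc p z.2))
      (Set.finite_range _).bddAbove (0, 1)

lemma constC₂_bsc (hp₁ : p < 1 / 2) : constC₂ (bsc p) = bscLLR p := by
  have hs (y : Fin 2) : ⨆ x, bsc p x y = 1 - p := by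
    refine le_antisymm (ciSup_le fun x => ?_) ?_
    · rw [bsc]; split_ifs <;> linarith
    · exact (by simp [bsc] : 1 - p ≤ bsc p y y).trans
        (le_ciSup (f := fun x => bsc p x y) (Set.finite_range _).bddAbove y)
  have hi (y : Fin 2) : ⨅ x, bsc p x y = p := by
    refine le_antisymm ?_ (le_ciInf fun x => ?_)
    · refine (ciInf_le (f := fun x => bsc p x y) (Set.finite_range _).bddBelow (y + 1)).trans ?_
      fin_cases y <;> simp [bsc]
    · rw [bsc]; split_ifs <;> linarith
  simp [constC₂, hs, hi, bscLLR]

end constants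

/-! ### One step of the log odds -/

lemma bsc_potential_condition {p : ℝ} (hp₀ : 0 < p) (hp₁ : p < 1 / 2) {K : ℝ} (hK : 0 < K) :
    bscLLR p / K ≤ bscLLR p ^ 2 / (K * ((1 - 2 * p) * bscLLR p))
      * (1 - (2 : ℝ) ^ (-bscLLR p)) := by
  have hL := bscLLR_pos hp₀ hp₁
  have h2 : 0 < 1 - 2 * p := by linarith
  have hq : 0 < 1 - p := by linarith
  rw [Real.rpow_neg two_pos.le, two_rpow_bscLLR hp₀ hp₁, inv_div]
  have e : bscLLR p ^ 2 / (K * ((1 - 2 * p) * bscLLR p)) * (1 - p / (1 - p))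
      = bscLLR p / K * (1 / (1 - p)) := by
    field_simp; ring
  rw [e]
  -- The right side exceeds the left by the factor 1/(1-p).
  exact le_mul_of_one_le_right (by positivity) (by rw [le_div_iff₀ hq]; linarith)

/-- The drift of the log odds of the sent message is at least the capacity when the competing
messages that share its channel input have at most half of the competing mass. -/
lemma bscCapacity_le_drift {p : ℝ} (hp₀ : 0 < p) (hp₁ : p < 1 / 2) {A B : ℝ} (hA : 0 ≤ A)
    (hAB : A ≤ B) (hS : 0 < A + B) :
    bscCapacity p ≤ (1 - p) * Real.logb 2 ((1 - p) * (A + B) / (A * (1 - p) + B * p))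
      + p * Real.logb 2 (p * (A + B) / (A * p + B * (1 - p))) := by
  have hB : 0 < B := by linarith
  have hq : 0 < 1 - p := by linarith
  have hr : 0 < A * (1 - p) + B * p := by positivity
  have hr' : 0 < A * p + B * (1 - p) := by positivity
  set r := (A * (1 - p) + B * p) / (A + B) with hr_def
  set r' := (A * p + B * (1 - p)) / (A + B) with hr'_def
  have hr0 : 0 < r := by positivity
  have hr'0 : 0 < r' := by positivity
  have hrr : r + r' = 1 := by rw [hr_def, hr'_def]; field_simp; ring
  have hle : r ≤ 1 / 2 := by
    rw [hr_def, div_le_div_iff₀ hS two_pos]; nlinarith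
  have e₁ : (1 - p) * (A + B) / (A * (1 - p) + B * p) = (1 - p) / r := by
    rw [hr_def]; field_simp
  have e₂ : p * (A + B) / (A * p + B * (1 - p)) = p / r' := by
    rw [hr'_def]; field_simp
  rw [e₁, e₂, Real.logb_div hq.ne' hr0.ne', Real.logb_div hp₀.ne' hr'0.ne', bscCapacity]
  have l₁ : Real.logb 2 r ≤ -1 := by
    have := Real.logb_le_logb_of_le one_lt_two hr0 hle
    rwa [one_div, Real.logb_inv, Real.logb_self_eq_one one_lt_two] at this
  -- This is r r' ≤ 1/4. The goal -(1-p) log r - p log r' ≥ 1 is (1-2p) times `l₁` plus p times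
  -- `l₂`.
  have l₂ : Real.logb 2 r + Real.logb 2 r' ≤ -2 := by
    rw [← Real.logb_mul hr0.ne' hr'0.ne', Real.logb_le_iff_le_rpow one_lt_two (by positivity),
      Real.rpow_neg two_pos.le]
    norm_num
    nlinarith [sq_nonneg (r - r')]
  nlinarith

/-- One step of the log odds of the sent message under the small-enough-difference rule. -/
lemma bsc_potential_step {p : ℝ} (hp₀ : 0 < p) (hp₁ : p < 1 / 2) {β m A B : ℝ} (hβ : 0 ≤ β)
    (hm : 0 < m) (hA : 0 ≤ A) (hAB : A ≤ B) (hS : 0 < A + B) (hlarge : A + B ≤ m → A = 0)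
    (hu : Real.logb 2 (m / (A + B)) < β) :
    (1 - p) * max (potential (bscCapacity p) ((1 - 2 * p) * bscLLR p) (bscLLR p) β
          (Real.logb 2 (m * (1 - p) / (A * (1 - p) + B * p)))) 0
      + p * max (potential (bscCapacity p) ((1 - 2 * p) * bscLLR p) (bscLLR p) β
          (Real.logb 2 (m * p / (A * p + B * (1 - p))))) 0 + 1
      ≤ max (potential (bscCapacity p) ((1 - 2 * p) * bscLLR p) (bscLLR p) β
          (Real.logb 2 (m / (A + B)))) 0 := by
  have hq : 0 < 1 - p := by linarith
  have hB : 0 < B := by linarith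
  have h₁ := bscCapacity_pos hp₁
  have h₃ := bscLLR_pos hp₀ hp₁
  have h₂ : 0 < (1 - 2 * p) * bscLLR p := mul_pos (by linarith) h₃
  have hK := bsc_potential_condition hp₀ hp₁ h₁
  have hr : 0 < A * (1 - p) + B * p := by positivity
  have hr' : 0 < A * p + B * (1 - p) := by positivity
  set u := Real.logb 2 (m / (A + B)) with hu_def
  set d := Real.logb 2 ((1 - p) * (A + B) / (A * (1 - p) + B * p)) with hd_def
  set d' := Real.logb 2 (p * (A + B) / (A * p + B * (1 - p))) with hd'_def
  have e₁ : Real.logb 2 (m * (1 - p) / (A * (1 - p) + B * p)) = u + d := by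
    rw [hu_def, hd_def, ← Real.logb_mul (by positivity) (by positivity)]
    congr 1; field_simp
  have e₂ : Real.logb 2 (m * p / (A * p + B * (1 - p))) = u + d' := by
    rw [hu_def, hd'_def, ← Real.logb_mul (by positivity) (by positivity)]
    congr 1; field_simp
  have hd : d ≤ bscLLR p := by
    refine Real.logb_le_logb_of_le one_lt_two (by positivity) ?_
    rw [div_le_div_iff₀ hr hp₀]
    nlinarith [mul_nonneg hA hq.le]
  have hd' : d' ≤ bscLLR p := by
    refine Real.logb_le_logb_of_le one_lt_two (by positivity) ?_
    rw [div_le_div_iff₀ hr' hp₀]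
    have : p * p ≤ (1 - p) * (1 - p) := by nlinarith
    nlinarith [mul_nonneg hA hq.le, mul_le_mul_of_nonneg_left this hB.le,
      mul_nonneg hA hp₀.le]
  -- All three arguments are at most β + C₂, so the truncation at 0 has no effect.
  rw [e₁, e₂, max_eq_left (potential_nonneg h₁ h₂ h₃ hβ (by linarith)),
    max_eq_left (potential_nonneg h₁ h₂ h₃ hβ (by linarith)),
    max_eq_left (potential_nonneg h₁ h₂ h₃ hβ (by linarith))]
  rcases lt_or_ge u 0 with hneg | hnn
  · exact potential_step_of_neg h₁ h₂ h₃ hK hq.le hp₀.le (by ring) hneg hd hd'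
      (bscCapacity_le_drift hp₀ hp₁ hA hAB hS)
  · obtain rfl : A = 0 := hlarge <| by
      have := (Real.logb_nonneg_iff one_lt_two (by positivity)).1 hnn
      rwa [le_div_iff₀ hS, one_mul] at this
    have ed : d = bscLLR p := by
      rw [hd_def, bscLLR]; congr 1; field_simp; ring
    have ed' : d' = -bscLLR p := by
      rw [hd'_def, ← bscLLR_inv]; congr 1; field_simp; ring
    rw [ed, ed']
    refine potential_step_of_nonneg h₁ h₂ h₃ hK hq.le hp₀.le (by ring) hnn (by ring) ?_
    rw [Real.rpow_neg two_pos.le, two_rpow_bscLLR hp₀ hp₁]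
    field_simp
    ring


/-! ### Joint probabilities of message and outputs -/

section transmission

variable {Ω A B : Type*}

lemma history_succ_eq_snoc_iff {Y : ℕ → Ω → B} {t : ℕ} {y : Fin t → B} {b : B} {ω : Ω} :
    history Y (t + 1) ω = (Fin.snoc y b : Fin (t + 1) → B)
      ↔ history Y t ω = y ∧ Y t ω = b := by
  have e : history Y (t + 1) ω = (Fin.snoc (history Y t ω) (Y t ω) : Fin (t + 1) → B) := by
    ext k
    refine Fin.lastCases ?_ (fun k => ?_) k
    · simp [history]
    · simp [history]
  rw [e, Fin.snoc_inj]

variable [MeasurableSpace Ω] {μ : Measure Ω} {M : ℕ} {θ : Ω → Fin M} {Y : ℕ → Ω → B}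

/-- The joint probability `Pr{θ = i, Y^t = y}`. -/
noncomputable def jointProb (μ : Measure Ω) (θ : Ω → Fin M) (Y : ℕ → Ω → B) (t : ℕ)
    (y : Fin t → B) (i : Fin M) : ℝ :=
  μ.real {ω | θ ω = i ∧ history Y t ω = y}

/-- The logarithm of the posterior odds of the message `i` after the outputs `y`. -/
noncomputable def logOdds (μ : Measure Ω) (θ : Ω → Fin M) (Y : ℕ → Ω → B) (t : ℕ)
    (y : Fin t → B) (i : Fin M) : ℝ :=
  Real.logb 2 (jointProb μ θ Y t y i / ∑ j ∈ Finset.univ.erase i, jointProb μ θ Y t y j)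

/-- The transmission has not stopped by time `t` when the outputs are `y`. -/
def Active (μ : Measure Ω) (θ : Ω → Fin M) (Y : ℕ → Ω → B) (ε : ℝ) (t : ℕ)
    (y : Fin t → B) : Prop :=
  ∀ (s : ℕ) (hs : s ≤ t) (i : Fin M),
    belief μ θ Y s (fun k => y (Fin.castLE hs k)) i < 1 - ε

lemma lt_stopTime_iff {ε : ℝ} {t : ℕ} {ω : Ω} :
    (t : ℕ∞) < stopTime μ θ Y ε ω ↔ Active μ θ Y ε t (history Y t ω) := by
  rw [← not_le, stopTime]
  constructor
  · intro h s hs i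
    by_contra hb
    have hmem : s ∈ {t : ℕ | ∃ i, 1 - ε ≤ posterior μ θ Y i t ω} := ⟨i, not_lt.1 hb⟩
    exact h ((sInf_le (Set.mem_image_of_mem _ hmem)).trans (Nat.cast_le.2 hs))
  · intro h hle
    -- A strict bound is needed to extract a witness from the infimum, hence t + 1.
    obtain ⟨_, ⟨s, ⟨i, hi⟩, rfl⟩, hst⟩ :=
      sInf_lt_iff.1 (hle.trans_lt (by exact_mod_cast Nat.lt_succ_self t :
        (t : ℕ∞) < ((t + 1 : ℕ) : ℕ∞)))
    have hs : s ≤ t := Nat.lt_succ_iff.1 (Nat.cast_lt.1 hst)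
    exact (h s hs i).not_ge hi

lemma Active.init {ε : ℝ} {t : ℕ} {y : Fin t → B} {b : B}
    (h : Active μ θ Y ε (t + 1) (Fin.snoc y b : Fin (t + 1) → B)) : Active μ θ Y ε t y := by
  intro s hs i
  convert h s (hs.trans t.le_succ) i using 2
  ext k
  have : Fin.castLE (hs.trans t.le_succ) k = (Fin.castLE hs k).castSucc := rfl
  rw [this, Fin.snoc_castSucc (α := fun _ => B)]

lemma jointProb_snoc [MeasurableSpace B] {W : A → B → ℝ} {e : Encoder M A B}
    (hT : IsTransmission W μ θ Y e) (t : ℕ) (y : Fin t → B) (b : B) (i : Fin M) :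
    jointProb μ θ Y (t + 1) (Fin.snoc y b : Fin (t + 1) → B) i
      = jointProb μ θ Y t y i * W (e t i y) b := by
  simp only [jointProb, ← hT.channel, history_succ_eq_snoc_iff]

lemma jointProb_zero [MeasurableSpace B] {W : A → B → ℝ} {e : Encoder M A B}
    (hT : IsTransmission W μ θ Y e) (y : Fin 0 → B) (i : Fin M) :
    jointProb μ θ Y 0 y i = 1 / (M : ℝ) := by
  simp only [jointProb, ← hT.uniform i, Subsingleton.elim (history Y 0 _) y, and_true]

lemma jointProb_pos [MeasurableSpace B] {W : A → B → ℝ} {e : Encoder M A B}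
    (hT : IsTransmission W μ θ Y e) (hW : ∀ x b, 0 < W x b) {t : ℕ} (y : Fin t → B)
    (i : Fin M) : 0 < jointProb μ θ Y t y i := by
  induction t with
  | zero =>
    rw [jointProb_zero hT]
    have : 0 < M := i.pos
    positivity
  | succ t ih =>
    rw [← Fin.snoc_init_self y, jointProb_snoc hT]
    exact mul_pos (ih _) (hW _ _)

lemma tsum_measure_lt_eq_lintegral {τ : Ω → ℕ∞} (hτ : ∀ t : ℕ, MeasurableSet {ω | (t : ℕ∞) < τ ω}) :
    ∫⁻ ω, (τ ω : ENNReal) ∂μ = ∑' t : ℕ, μ {ω | (t : ℕ∞) < τ ω} := by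
  have h (n : ℕ∞) : (n : ENNReal) = ∑' t : ℕ, {t : ℕ | (t : ℕ∞) < n}.indicator 1 t := by
    have : n = {t : ℕ | (t : ℕ∞) < n}.encard := by
      induction n using ENat.recTopCoe with
      | top => simp [Set.encard_univ]
      | coe n =>
        have : {t : ℕ | (t : ℕ∞) < (n : ℕ∞)} = (Finset.range n : Set ℕ) := by ext; simp
        rw [this, Set.encard_coe_eq_coe_finsetCard, Finset.card_range]
    rw [← tsum_subtype]
    simp only [Pi.one_apply]
    rw [ENNReal.tsum_set_one, ← this]
  calc ∫⁻ ω, (τ ω : ENNReal) ∂μ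
      = ∫⁻ ω, ∑' t : ℕ, {ω | (t : ℕ∞) < τ ω}.indicator 1 ω ∂μ := by
        refine lintegral_congr fun ω => ?_
        rw [h]; rfl
    _ = ∑' t : ℕ, ∫⁻ ω, {ω | (t : ℕ∞) < τ ω}.indicator 1 ω ∂μ :=
        lintegral_tsum fun t => (measurable_one.indicator (hτ t)).aemeasurable
    _ = _ := by simp only [lintegral_indicator_one (hτ _)]

lemma measurable_history [MeasurableSpace B] (hY : ∀ t, Measurable (Y t)) (t : ℕ) : Measurable (history Y t) :=
  measurable_pi_lambda _ fun k => hY k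

variable [MeasurableSpace B] [MeasurableSingletonClass B] [Fintype B] [IsProbabilityMeasure μ]

lemma measureReal_history_eq (hθ : Measurable θ) (hY : ∀ t, Measurable (Y t)) (t : ℕ)
    (P : (Fin t → B) → Prop) [DecidablePred P] :
    μ.real {ω | P (history Y t ω)}
      = ∑ i, ∑ y, if P y then jointProb μ θ Y t y i else 0 := by
  have hm : Measurable fun ω => (θ ω, history Y t ω) := hθ.prodMk (measurable_history hY t)
  have := sum_measureReal_preimage_singleton (μ := μ)
    (Finset.univ.filter fun z : Fin M × (Fin t → B) => P z.2)
    (f := fun ω => (θ ω, history Y t ω)) (fun z _ => hm (measurableSet_singleton z))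
  rw [Finset.sum_filter, Fintype.sum_prod_type] at this
  convert this.symm using 1
  · congr 1; ext ω; simp
  · refine Finset.sum_congr rfl fun i _ => Finset.sum_congr rfl fun y _ => ?_
    congr 1
    simp only [jointProb]
    congr 1; ext ω; simp

lemma belief_eq (hθ : Measurable θ) (hY : ∀ t, Measurable (Y t)) (t : ℕ) (y : Fin t → B)
    (i : Fin M) :
    belief μ θ Y t y i = jointProb μ θ Y t y i / ∑ j, jointProb μ θ Y t y j := by
  classical
  have hs : MeasurableSet {ω | history Y t ω = y} :=
    measurable_history hY t (measurableSet_singleton y)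
  have ht : μ.real {ω | history Y t ω = y} = ∑ j, jointProb μ θ Y t y j := by
    rw [measureReal_history_eq hθ hY t (fun z => z = y)]
    simp
  rw [belief, measureReal_def, ProbabilityTheory.cond_apply hs, ENNReal.toReal_mul,
    ENNReal.toReal_inv, ← ht, div_eq_inv_mul]
  congr 1
  simp only [jointProb, measureReal_def]
  congr 2; ext ω; simp [and_comm]

end transmission

/-! ### The SED rule and the decrease of the mean potential -/

section bsc

variable {Ω : Type*} [MeasurableSpace Ω] {μ : Measure Ω} {p ε : ℝ}
  {M : ℕ} {θ : Ω → Fin M} {Y : ℕ → Ω → Fin 2} {e : Encoder M (Fin 2) (Fin 2)}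

lemma bsc_pos (hp₀ : 0 < p) (hp₁ : p < 1 / 2) (x y : Fin 2) : 0 < bsc p x y := by
  rw [bsc]; split_ifs <;> linarith

lemma bsc_self (p : ℝ) (x : Fin 2) : bsc p x x = 1 - p := if_pos rfl

lemma bsc_flip_left (p : ℝ) (x : Fin 2) : bsc p (1 - x) x = p := by
  fin_cases x <;> simp [bsc]

lemma bsc_flip_right (p : ℝ) (x : Fin 2) : bsc p x (1 - x) = p := by
  fin_cases x <;> simp [bsc]

lemma sum_bsc_mul (p : ℝ) (x : Fin 2) (f : Fin 2 → ℝ) :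
    ∑ b, bsc p x b * f b = (1 - p) * f x + p * f (1 - x) := by
  fin_cases x <;> simp [bsc, Fin.sum_univ_two, add_comm]

/-- The probability of the messages other than `i`, weighted by the outputs `y`, that are sent
with the symbol `x`. -/
noncomputable def otherMass (μ : Measure Ω) (θ : Ω → Fin M) (Y : ℕ → Ω → Fin 2)
    (e : Encoder M (Fin 2) (Fin 2)) (t : ℕ) (y : Fin t → Fin 2) (i : Fin M) (x : Fin 2) : ℝ :=
  ∑ j ∈ Finset.univ.erase i with e t j y = x, jointProb μ θ Y t y j

lemma sum_erase_eq_otherMass (f : Fin 2 → ℝ) (t : ℕ) (y : Fin t → Fin 2) (i : Fin M)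
    (x : Fin 2) :
    ∑ j ∈ Finset.univ.erase i, jointProb μ θ Y t y j * f (e t j y)
      = otherMass μ θ Y e t y i x * f x + otherMass μ θ Y e t y i (1 - x) * f (1 - x) := by
  rw [← Finset.sum_fiberwise (g := fun j => e t j y), Fin.sum_univ_two]
  have h (x : Fin 2) : ∑ j ∈ Finset.univ.erase i with e t j y = x,
      jointProb μ θ Y t y j * f (e t j y) = otherMass μ θ Y e t y i x * f x := by
    rw [otherMass, Finset.sum_mul]
    refine Finset.sum_congr rfl fun j hj => ?_
    rw [(Finset.mem_filter.1 hj).2]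
  rw [h, h]
  fin_cases x <;> simp [add_comm]

lemma sum_filter_eq_otherMass (t : ℕ) (y : Fin t → Fin 2) (i : Fin M) (x : Fin 2) :
    ∑ j with e t j y = x, jointProb μ θ Y t y j
      = otherMass μ θ Y e t y i x + if e t i y = x then jointProb μ θ Y t y i else 0 := by
  rw [otherMass, Finset.sum_filter, Finset.sum_filter,
    ← Finset.sum_erase_add _ _ (Finset.mem_univ i)]

lemma logOdds_snoc (hT : IsTransmission (bsc p) μ θ Y e) (t : ℕ) (y : Fin t → Fin 2) (b : Fin 2)
    (i : Fin M) :
    logOdds μ θ Y (t + 1) (Fin.snoc y b : Fin (t + 1) → Fin 2) i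
      = Real.logb 2 (jointProb μ θ Y t y i * bsc p (e t i y) b
          / (otherMass μ θ Y e t y i (e t i y) * bsc p (e t i y) b
            + otherMass μ θ Y e t y i (1 - e t i y) * bsc p (1 - e t i y) b)) := by
  simp only [logOdds, jointProb_snoc hT]
  rw [sum_erase_eq_otherMass fun x => bsc p x b]

/-- The stopped potential of the message `i` after the outputs `y`. -/
noncomputable def messagePotential (μ : Measure Ω) (θ : Ω → Fin M) (Y : ℕ → Ω → Fin 2) (p ε : ℝ)
    (t : ℕ) (y : Fin t → Fin 2) (i : Fin M) : ℝ :=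
  max (potential (bscCapacity p) ((1 - 2 * p) * bscLLR p) (bscLLR p)
    (Real.logb 2 ((1 - ε) / ε)) (logOdds μ θ Y t y i)) 0

open Classical in
/-- The expected potential of the sent message on the event that the transmission has not
stopped by time `t`. -/
noncomputable def activePotential (μ : Measure Ω) (θ : Ω → Fin M) (Y : ℕ → Ω → Fin 2) (p ε : ℝ)
    (t : ℕ) : ℝ :=
  ∑ i, ∑ y, if Active μ θ Y ε t y
    then jointProb μ θ Y t y i * messagePotential μ θ Y p ε t y i else 0

lemma activePotential_nonneg (t : ℕ) : 0 ≤ activePotential μ θ Y p ε t := by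
  refine Finset.sum_nonneg fun i _ => Finset.sum_nonneg fun y _ => ?_
  split_ifs
  · exact mul_nonneg measureReal_nonneg (le_max_right _ _)
  · exact le_rfl

variable [IsProbabilityMeasure μ]

lemma partMass_history_eq (hT : IsTransmission (bsc p) μ θ Y e) (t : ℕ) (x : Fin 2) (ω : Ω) :
    partMass μ θ Y e x t ω = (∑ i with e t i (history Y t ω) = x,
      jointProb μ θ Y t (history Y t ω) i) / ∑ j, jointProb μ θ Y t (history Y t ω) j := by
  simp only [partMass, posterior, belief_eq hT.measurable_message hT.measurable_output,
    Finset.sum_div]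

/-- The small-enough-difference rule in terms of the mass that competes with the message `i`. -/
lemma IsSED.otherMass_le (hp₀ : 0 < p) (hp₁ : p < 1 / 2)
    (hT : IsTransmission (bsc p) μ θ Y e) (hSED : IsSED μ θ Y e ε) {t : ℕ} {y : Fin t → Fin 2}
    (hy : Active μ θ Y ε t y) (i : Fin M) :
    otherMass μ θ Y e t y i (e t i y) ≤ otherMass μ θ Y e t y i (1 - e t i y) ∧
    (otherMass μ θ Y e t y i (e t i y) + otherMass μ θ Y e t y i (1 - e t i y)
        ≤ jointProb μ θ Y t y i → otherMass μ θ Y e t y i (e t i y) = 0) := by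
  have hJ := jointProb_pos hT (bsc_pos hp₀ hp₁) y
  have hO (x : Fin 2) : 0 ≤ otherMass μ θ Y e t y i x :=
    Finset.sum_nonneg fun j _ => (hJ j).le
  obtain ⟨ω, -, rfl⟩ : ∃ ω, θ ω = i ∧ history Y t ω = y := by
    by_contra! h
    refine (hJ i).ne' ?_
    have : {ω | θ ω = i ∧ history Y t ω = y} = ∅ := by
      ext ω; simpa using h ω
    simp [jointProb, this]
  obtain ⟨h₀, h₁⟩ := hSED ω t (lt_stopTime_iff.2 hy)
  simp only [partMass_history_eq hT, posterior,
    belief_eq hT.measurable_message hT.measurable_output] at h₀ h₁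
  have hsum : 0 < ∑ j, jointProb μ θ Y t (history Y t ω) j :=
    Finset.sum_pos (fun j _ => hJ j) ⟨i, Finset.mem_univ i⟩
  rw [← sub_div, le_div_iff₀ hsum, zero_mul, sum_filter_eq_otherMass t _ i,
    sum_filter_eq_otherMass t _ i] at h₀
  simp only [← sub_div, div_le_div_iff_of_pos_right hsum, sum_filter_eq_otherMass t _ i] at h₁
  have hJi := hJ i
  obtain hx | hx : e t i (history Y t ω) = 0 ∨ e t i (history Y t ω) = 1 := by
    generalize e t i (history Y t ω) = x
    fin_cases x <;> simp
  · simp only [hx, zero_ne_one, if_true, if_false, sub_zero] at h₀ h₁ ⊢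
    refine ⟨by linarith [h₁ i hx], fun hle => ?_⟩
    -- A competitor j on input 0 would give m + A - B ≤ ρ_j ≤ A up to normalisation, so m ≤ B,
    -- against A + B ≤ m and A > 0.
    by_contra hne
    obtain ⟨j, hj, -⟩ := Finset.exists_ne_zero_of_sum_ne_zero hne
    have hj' := (Finset.mem_filter.1 hj).2
    have hge : jointProb μ θ Y t (history Y t ω) j
        ≤ otherMass μ θ Y e t (history Y t ω) i 0 :=
      Finset.single_le_sum (f := jointProb μ θ Y t (history Y t ω)) (fun k _ => (hJ k).le) hj
    linarith [h₁ j hj', hJ j, hO 1]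
  · simp only [hx, one_ne_zero, if_true, if_false, sub_self] at h₀ h₁ ⊢
    -- Here the left SED inequality reads m + A ≤ B.
    exact ⟨by linarith, fun hle => by linarith [hO 1]⟩

lemma Active.jointProb_lt (hp₀ : 0 < p) (hp₁ : p < 1 / 2) (hT : IsTransmission (bsc p) μ θ Y e)
    {t : ℕ} {y : Fin t → Fin 2} (hy : Active μ θ Y ε t y) (i : Fin M) :
    jointProb μ θ Y t y i * ε
      < (1 - ε) * ∑ j ∈ Finset.univ.erase i, jointProb μ θ Y t y j := by
  have hJ := jointProb_pos hT (bsc_pos hp₀ hp₁) y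
  have h := hy t le_rfl i
  have hsum : 0 < ∑ j, jointProb μ θ Y t y j :=
    Finset.sum_pos (fun j _ => hJ j) ⟨i, Finset.mem_univ i⟩
  simp only [Fin.castLE_rfl, id_eq] at h
  rw [belief_eq hT.measurable_message hT.measurable_output, div_lt_iff₀ hsum,
    ← Finset.sum_erase_add _ _ (Finset.mem_univ i)] at h
  linarith

lemma messagePotential_step (hp₀ : 0 < p) (hp₁ : p < 1 / 2) (hε₀ : 0 < ε) (hε₁ : ε ≤ 1 / 2)
    (hT : IsTransmission (bsc p) μ θ Y e) (hSED : IsSED μ θ Y e ε) {t : ℕ} {y : Fin t → Fin 2}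
    (hy : Active μ θ Y ε t y) (i : Fin M) :
    ∑ b, bsc p (e t i y) b
        * messagePotential μ θ Y p ε (t + 1) (Fin.snoc y b : Fin (t + 1) → Fin 2) i + 1
      ≤ messagePotential μ θ Y p ε t y i := by
  have hJ := jointProb_pos hT (bsc_pos hp₀ hp₁) y
  have hε : 0 < 1 - ε := by linarith
  obtain ⟨hAB, hlarge⟩ := hSED.otherMass_le hp₀ hp₁ hT hy i
  have hR : ∑ j ∈ Finset.univ.erase i, jointProb μ θ Y t y j
      = otherMass μ θ Y e t y i (e t i y) + otherMass μ θ Y e t y i (1 - e t i y) := by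
    simpa using sum_erase_eq_otherMass (μ := μ) (θ := θ) (Y := Y) (e := e) (fun _ => 1) t y i
      (e t i y)
  have hlt := hy.jointProb_lt hp₀ hp₁ hT i
  rw [hR] at hlt
  have hS : 0 < otherMass μ θ Y e t y i (e t i y) + otherMass μ θ Y e t y i (1 - e t i y) :=
    pos_of_mul_pos_right ((mul_pos (hJ i) hε₀).trans hlt) hε.le
  have hu : Real.logb 2 (jointProb μ θ Y t y i / (otherMass μ θ Y e t y i (e t i y)
      + otherMass μ θ Y e t y i (1 - e t i y))) < Real.logb 2 ((1 - ε) / ε) :=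
    Real.logb_lt_logb one_lt_two (div_pos (hJ i) hS) ((div_lt_div_iff₀ hS hε₀).2 hlt)
  have hβ : 0 ≤ Real.logb 2 ((1 - ε) / ε) :=
    Real.logb_nonneg one_lt_two ((one_le_div hε₀).2 (by linarith))
  have key := bsc_potential_step hp₀ hp₁ hβ (hJ i)
    (Finset.sum_nonneg fun j _ => (hJ j).le) hAB hS hlarge hu
  rw [sum_bsc_mul]
  simp only [messagePotential, logOdds_snoc hT, bsc_self, bsc_flip_left, bsc_flip_right]
  rwa [logOdds, hR]

lemma measureReal_lt_stopTime_le (hp₀ : 0 < p) (hp₁ : p < 1 / 2) (hε₀ : 0 < ε)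
    (hε₁ : ε ≤ 1 / 2) (hT : IsTransmission (bsc p) μ θ Y e) (hSED : IsSED μ θ Y e ε) (t : ℕ) :
    μ.real {ω | (t : ℕ∞) < stopTime μ θ Y ε ω}
      ≤ activePotential μ θ Y p ε t - activePotential μ θ Y p ε (t + 1) := by
  classical
  simp only [lt_stopTime_iff]
  rw [measureReal_history_eq hT.measurable_message hT.measurable_output, le_sub_iff_add_le]
  simp only [activePotential, ← Finset.sum_add_distrib]
  refine Finset.sum_le_sum fun i _ => ?_
  rw [← (Fin.snocEquiv fun _ => Fin 2).sum_comp, Fintype.sum_prod_type_right,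
    ← Finset.sum_add_distrib]
  refine Finset.sum_le_sum fun y _ => ?_
  have hJ {t : ℕ} (y : Fin t → Fin 2) := jointProb_pos hT (bsc_pos hp₀ hp₁) y
  by_cases hy : Active μ θ Y ε t y
  · simp only [hy, if_true]
    have h := mul_le_mul_of_nonneg_left
      (messagePotential_step hp₀ hp₁ hε₀ hε₁ hT hSED hy i) (hJ y i).le
    refine le_trans ?_ h
    rw [mul_add, mul_one, add_comm, Finset.mul_sum]
    gcongr with b _
    rw [← mul_assoc, ← jointProb_snoc hT]
    -- Successors at which transmission stops are dropped; their truncated potential is nonnegative.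
    split_ifs
    · exact le_rfl
    · exact mul_nonneg (hJ _ i).le (le_max_right _ _)
  · rw [if_neg hy, if_neg hy, zero_add]
    refine Finset.sum_nonpos fun b _ => ?_
    split_ifs with h
    · exact absurd (Active.init h) hy
    · exact le_rfl

open Classical in
lemma activePotential_zero_le (hp₀ : 0 < p) (hp₁ : p < 1 / 2) (hε₀ : 0 < ε) (hε₁ : ε ≤ 1 / 2)
    (hM : 1 ≤ M) (hT : IsTransmission (bsc p) μ θ Y e) :
    activePotential μ θ Y p ε 0 ≤ Real.logb 2 M / bscCapacity p
      + Real.logb 2 ((1 - ε) / ε) / ((1 - 2 * p) * bscLLR p)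
      + 3 * bscLLR p ^ 2 / (bscCapacity p * ((1 - 2 * p) * bscLLR p)) := by
  have h₁ := bscCapacity_pos hp₁
  have h₃ := bscLLR_pos hp₀ hp₁
  have h₂ : 0 < (1 - 2 * p) * bscLLR p := mul_pos (by linarith) h₃
  have h₁₃ := bscCapacity_le_bscLLR hp₀ hp₁
  have hβ : 0 ≤ Real.logb 2 ((1 - ε) / ε) :=
    Real.logb_nonneg one_lt_two ((one_le_div hε₀).2 (by linarith))
  have hMr : (1 : ℝ) ≤ M := by exact_mod_cast hM
  have hlog : 0 ≤ Real.logb 2 M := Real.logb_nonneg one_lt_two hMr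
  set R := Real.logb 2 M / bscCapacity p
      + Real.logb 2 ((1 - ε) / ε) / ((1 - 2 * p) * bscLLR p)
      + 3 * bscLLR p ^ 2 / (bscCapacity p * ((1 - 2 * p) * bscLLR p)) with hR
  have hR0 : 0 ≤ R := by positivity
  have hterm (i : Fin M) : (∑ y, if Active μ θ Y ε 0 y
      then jointProb μ θ Y 0 y i * messagePotential μ θ Y p ε 0 y i else 0) ≤ 1 / (M : ℝ) * R := by
    rw [Fintype.sum_unique]
    split_ifs with hy
    · rw [jointProb_zero hT]
      refine mul_le_mul_of_nonneg_left (max_le ?_ hR0) (by positivity)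
      have hlt := hy.jointProb_lt hp₀ hp₁ hT i
      simp only [logOdds]
      simp only [jointProb_zero hT, Finset.sum_const, Finset.card_erase_of_mem (Finset.mem_univ i),
        Finset.card_univ, Fintype.card_fin, nsmul_eq_mul, Nat.cast_sub hM, Nat.cast_one] at hlt ⊢
      -- For M = 1 the belief is 1 and transmission stops at time 0, so activity forces M ≥ 2.
      have hM1 : (0 : ℝ) < M - 1 := by
        have h : 0 < (1 - ε) * (((M : ℝ) - 1) * (1 / M)) := lt_trans (by positivity) hlt
        have := pos_of_mul_pos_right h (by linarith : 0 ≤ 1 - ε)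
        exact pos_of_mul_pos_left this (by positivity)
      have hM2 : (1 : ℝ) ≤ M - 1 := by
        have : 1 < M := by exact_mod_cast (by linarith : (1 : ℝ) < M)
        have : (2 : ℝ) ≤ M := by exact_mod_cast this
        linarith
      have e : Real.logb 2 (1 / (M : ℝ) / (((M : ℝ) - 1) * (1 / M)))
          = -Real.logb 2 ((M : ℝ) - 1) := by
        rw [← Real.logb_inv]; congr 1; field_simp
      have hle : Real.logb 2 ((M : ℝ) - 1) ≤ Real.logb 2 M :=
        Real.logb_le_logb_of_le one_lt_two hM1 (by linarith)
      have hnn : 0 ≤ Real.logb 2 ((M : ℝ) - 1) := Real.logb_nonneg one_lt_two hM2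
      rw [e]
      -- For M = 2 the initial log odds are 0, on the upper branch, so the linear majorant is used.
      refine (potential_le_linear h₁ h₂ h₃ (bsc_potential_condition hp₀ hp₁ h₁)
        (by linarith)).trans ?_
      have i₁ : Real.logb 2 ((M : ℝ) - 1) / bscCapacity p ≤ Real.logb 2 M / bscCapacity p := by
        gcongr
      -- The overshoot term C₂/C₁ is absorbed using C ≤ C₂. This makes two copies of C₂²/(C C₁); the
      -- third is slack.
      have i₂ : bscLLR p / ((1 - 2 * p) * bscLLR p)
          ≤ bscLLR p ^ 2 / (bscCapacity p * ((1 - 2 * p) * bscLLR p)) := by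
        rw [div_le_div_iff₀ h₂ (by positivity)]
        have := mul_le_mul_of_nonneg_right h₁₃ (mul_nonneg h₃.le h₂.le)
        linarith
      have i₃ : 0 ≤ bscLLR p ^ 2 / (bscCapacity p * ((1 - 2 * p) * bscLLR p)) := by positivity
      rw [hR, add_div, neg_div, mul_div_assoc]
      linarith
    · positivity
  calc activePotential μ θ Y p ε 0 ≤ ∑ _i : Fin M, 1 / (M : ℝ) * R :=
        Finset.sum_le_sum fun i _ => hterm i
    _ = R := by
        simp only [Finset.sum_const, Finset.card_univ, Fintype.card_fin, nsmul_eq_mul]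
        field_simp

end bsc

end FeedbackBSC

open FeedbackBSC
theorem corollary1 {Ω : Type*} [MeasurableSpace Ω] (μ : MeasureTheory.Measure Ω)
    [MeasureTheory.IsProbabilityMeasure μ]
    (p : ℝ) (hp₀ : 0 < p) (hp₁ : p < 1 / 2)
    (ε : ℝ) (hε₀ : 0 < ε) (hε₁ : ε ≤ 1 / 2)
    (M : ℕ) (hM : 1 ≤ M)
    (θ : Ω → Fin M) (Y : ℕ → Ω → Fin 2) (e : Encoder M (Fin 2) (Fin 2))
    (hT : IsTransmission (bsc p) μ θ Y e) (hSED : IsSED μ θ Y e ε) :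
    ∫⁻ ω, (stopTime μ θ Y ε ω : ENNReal) ∂μ
      ≤ ENNReal.ofReal
          (Real.logb 2 M / capacity (bsc p)
            + Real.logb 2 ((1 - ε) / ε) / constC₁ (bsc p)
            + 3 * constC₂ (bsc p) ^ 2 / (capacity (bsc p) * constC₁ (bsc p))) := by
  have hmeas (t : ℕ) : MeasurableSet {ω | (t : ℕ∞) < stopTime μ θ Y ε ω} := by
    simp only [lt_stopTime_iff]
    exact measurable_history hT.measurable_output t
      (Set.toFinite {y | Active μ θ Y ε t y}).measurableSet
  rw [capacity_bsc hp₀ hp₁, constC₁_bsc hp₀ hp₁, constC₂_bsc hp₁,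
    tsum_measure_lt_eq_lintegral hmeas]
  -- Bounding the partial sums of P(τ > t) suffices, and these telescope.
  refine ENNReal.tsum_le_of_sum_range_le fun n => ?_
  have hsum : ∑ t ∈ Finset.range n, μ {ω | (t : ℕ∞) < stopTime μ θ Y ε ω}
      = ENNReal.ofReal (∑ t ∈ Finset.range n, μ.real {ω | (t : ℕ∞) < stopTime μ θ Y ε ω}) := by
    rw [ENNReal.ofReal_sum_of_nonneg fun t _ => MeasureTheory.measureReal_nonneg]
    simp
  rw [hsum]
  refine ENNReal.ofReal_le_ofReal (le_trans ?_
    (activePotential_zero_le hp₀ hp₁ hε₀ hε₁ hM hT))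
  refine (Finset.sum_le_sum fun t _ =>
    measureReal_lt_stopTime_le hp₀ hp₁ hε₀ hε₁ hT hSED t).trans ?_
  rw [Finset.sum_range_sub']
  exact sub_le_self _ (activePotential_nonneg n)
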